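/- Let $0<\alpha<1$, $T>0$, $J=[0,T]$, and let $B$ be a normalization function, i.e. $B>0$ on $[0,1]$ and $B(0)=B(1)=1$. Let $\mathbb{E}_\alpha(z)=\sum_{n=0}^{\infty}\frac{z^n}{\Gamma(n\alpha+1)}$ be the one-parameter Mittag-Leffler function. For a function $\omega:J\to\mathbb{R}$ that is differentiable on $J$ (one-sidedly at the end points) with $\omega'\in L^1(0,T)$, the left Atangana--Baleanu--Caputo (ABC) fractional derivative of order $\alpha$ is $$ {}^{ABC}{_0}\mathcal{D}_\tau^\alpha\,\omega(\tau)=\frac{B(\alpha)}{1-\alpha}\int_0^\tau \mathbb{E}_\alpha\!\left[-\frac{\alpha}{1-\alpha}(\tau-\sigma)^\alpha\right]\omega'(\sigma)\,d\sigma,\qquad \tau\in J . $$ **Theorem (strict comparison principle).** Let $f:J\times\mathbb{R}\to\mathbb{R}$ be continuous. Let $v,w:J\to\mathbb{R}$ be differentiable on $J$ with $v',w'\in L^1(0,T)$ (in particular, this covers all differentiable $v,w\in H^1(0,T)$), and suppose that ${}^{ABC}{_0}\mathcal{D}_\tau^\alpha v$ and ${}^{ABC}{_0}\mathcal{D}_\tau^\alpha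 w$ are continuous on $J$ and satisfy (i) ${}^{ABC}{_0}\mathcal{D}_\tau^\alpha v(\tau)\le f(\tau,v(\tau))$ for all $\tau\in J$, (ii) ${}^{ABC}{_0}\mathcal{D}_\tau^\alpha w(\tau)\ge f(\tau,w(\tau))$ for all $\tau\in J$, where one of the two inequalities is strict for all $\tau\in J$. If $v(0)<w(0)$, then $v(\tau)<w(\tau)$ for all $\tau\in J$. -/

import Mathlib

open Set MeasureTheory

/-- The one-parameter Mittag-Leffler function `E_α(z) = ∑ zⁿ / Γ(nα + 1)` of a real argument
(the series converges for all real `z` as soon as `0 < α`). -/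
noncomputable def mittagLeffler (α z : ℝ) : ℝ :=
  ∑' n : ℕ, z ^ n / Real.Gamma (n * α + 1)

/-- A normalization function: positive on `[0, 1]`, with value `1` at `0` and at `1`. -/
def IsNormalizationFunction (B : ℝ → ℝ) : Prop :=
  (∀ a ∈ Icc (0 : ℝ) 1, 0 < B a) ∧ B 0 = 1 ∧ B 1 = 1

/-- The left Atangana-Baleanu-Caputo fractional derivative of order `α` with base point `0`:
`B(α)/(1-α) ∫₀^τ E_α(-(α/(1-α)) (τ-σ)^α) ω'(σ) dσ`.
For `ω` differentiable on `[0, T]` and `τ ∈ [0, T]`, only the values of `ω'` on the open interval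
`(0, τ)` matter, and there `deriv ω` does not depend on the values of `ω` outside `[0, T]`. -/
noncomputable def abcDeriv (B : ℝ → ℝ) (α : ℝ) (ω : ℝ → ℝ) (τ : ℝ) : ℝ :=
  B α / (1 - α) *
    ∫ σ in (0 : ℝ)..τ, mittagLeffler α (-(α / (1 - α)) * (τ - σ) ^ α) * deriv ω σ

/-! At the first time `τ` where `v - w` vanishes, `v - w` is maximal over `[0, τ]`. If the ABC
derivative of `v` at `τ` is then at least that of `w`, the strict inequality is contradicted, since
`f τ (v τ) = f τ (w τ)`. The derivative comparison is `integral_mul_nonneg_of_monotoneOn` with `g =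
v' - w'`, whose tails are nonnegative by maximality. It needs the kernel to be nonnegative and
nondecreasing in `σ`, that is, `E_α` to be so on `(-∞, 0]`. The same lemma gives this: `u_l(t) =
E_α(-l t^α)` solves the Caputo equation `D^α u = -l u`, whose kernel `(t - s)^(-α)` is increasing,
so a minimum principle compares `u_l` for different `l`. -/

/-! ### Integration tools -/

/-- The sum of a series whose `L¹` norms are summable is integrable. -/
theorem integrable_tsum_of_summable_integral_norm {X : Type*} [MeasurableSpace X] {μ : Measure X}
    {F : ℕ → X → ℝ} (hF : ∀ n, Integrable (F n) μ) (hsum : Summable fun n => ∫ a, ‖F n a‖ ∂μ) :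
    Integrable (fun a => ∑' n, F n a) μ := by
  have hmeas : ∀ n, AEMeasurable (fun a => ‖F n a‖ₑ) μ := fun n => (hF n).1.enorm
  have hfin : ∑' n, ∫⁻ a, ‖F n a‖ₑ ∂μ ≠ ⊤ := by
    have h : ∀ n, ∫⁻ a, ‖F n a‖ₑ ∂μ = ENNReal.ofReal (∫ a, ‖F n a‖ ∂μ) := fun n => by
      rw [ofReal_integral_norm_eq_lintegral_enorm (hF n)]
    simp_rw [h]
    exact hsum.tsum_ofReal_ne_top
  rw [← lintegral_tsum hmeas] at hfin
  have hae : ∀ᵐ a ∂μ, Summable fun n => F n a := by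
    filter_upwards [ae_lt_top' (AEMeasurable.tsum hmeas) hfin] with a ha
    refine Summable.of_norm ?_
    exact ENNReal.tsum_coe_ne_top_iff_summable_coe.1 ha.ne
  refine ⟨?_, lt_of_le_of_lt (lintegral_mono fun a => ?_) hfin.lt_top⟩
  · refine aestronglyMeasurable_of_tendsto_ae (u := Filter.atTop)
      (f := fun (s : Finset ℕ) a => ∑ n ∈ s, F n a) ?_ ?_
    · exact fun s => Finset.aestronglyMeasurable_fun_sum s fun n _ => (hF n).1
    filter_upwards [hae] with a ha using ha.hasSum
  · exact enorm_tsum_le_tsum_enorm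

/-- If `k` is nonnegative and nondecreasing on `(0, τ)` and all the tails `∫_c^τ g` are
nonnegative, then `∫_0^τ k g` is nonnegative. -/
theorem integral_mul_nonneg_of_monotoneOn {τ : ℝ} {k g : ℝ → ℝ}
    (hk₀ : ∀ x ∈ Ioo 0 τ, 0 ≤ k x) (hk : MonotoneOn k (Ioo 0 τ))
    (hg : IntegrableOn g (Ioo 0 τ)) (hkg : IntegrableOn (fun x => k x * g x) (Ioo 0 τ))
    (htail : ∀ c ∈ Ico 0 τ, 0 ≤ ∫ x in Ioo c τ, g x) :
    0 ≤ ∫ x in Ioo 0 τ, k x * g x := by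
  set μ : Measure ℝ := volume.restrict (Ioo 0 τ) with hμ
  set ν : Measure ℝ := volume.restrict (Ioi 0) with hν
  have hkm : AEMeasurable k μ := aemeasurable_restrict_of_monotoneOn measurableSet_Ioo hk
  -- Layer cake: `k x = ∫_{s > 0} 1_{s < k x} ds`. After Fubini, `g` is integrated over superlevel
  -- sets of `k`.
  let G : ℝ → ℝ → ℝ := fun x s => (Iio (k x)).indicator (fun _ => g x) s
  have hGswap : ∀ x s, G x s = {y | s < k y}.indicator g x := fun x s => by
    simp [G, indicator]
  have hlevel : ∀ x ∈ Ioo 0 τ, ∀ c, ∫ s, (Iio (k x)).indicator (fun _ => c) s ∂ν = k x * c := by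
    intro x hx c
    rw [integral_indicator measurableSet_Iio, hν, Measure.restrict_restrict measurableSet_Iio,
      Iio_inter_Ioi, setIntegral_const]
    simp [Measure.real, hk₀ x hx]
  have hGint : Integrable (Function.uncurry G) (μ.prod ν) := by
    have hm : AEStronglyMeasurable (Function.uncurry G) (μ.prod ν) := by
      have hset : NullMeasurableSet {p : ℝ × ℝ | p.2 < k p.1} (μ.prod ν) :=
        nullMeasurableSet_lt measurable_snd.aemeasurable hkm.comp_fst
      have : Function.uncurry G = {p : ℝ × ℝ | p.2 < k p.1}.indicator fun p => g p.1 := by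
        ext ⟨x, s⟩
        simp [Function.uncurry, G, indicator]
      rw [this]
      exact (hg.1.comp_fst).indicator₀ hset
    rw [integrable_prod_iff hm]
    refine ⟨.of_forall fun x => ?_, ?_⟩
    · simp only [Function.uncurry, G]
      rw [integrable_indicator_iff measurableSet_Iio]
      refine integrableOn_const ?_
      rw [hν, Measure.restrict_apply measurableSet_Iio, Iio_inter_Ioi]
      simp
    · refine (hkg.norm).congr ?_
      filter_upwards [ae_restrict_mem measurableSet_Ioo] with x hx
      simp only [Function.uncurry, G, norm_indicator_eq_indicator_norm]
      rw [hlevel x hx, norm_mul, Real.norm_of_nonneg (hk₀ x hx)]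
  have hswap := integral_integral_swap hGint
  have hleft : ∫ x, ∫ s, G x s ∂ν ∂μ = ∫ x in Ioo 0 τ, k x * g x :=
    setIntegral_congr_fun measurableSet_Ioo fun x hx => hlevel x hx (g x)
  rw [← hleft, hswap]
  refine integral_nonneg fun s => ?_
  simp only [hGswap, Pi.zero_apply]
  have hset : NullMeasurableSet {y | s < k y} μ :=
    nullMeasurableSet_lt aemeasurable_const hkm
  rw [integral_indicator₀ hset]
  set S : Set ℝ := {y | s < k y} ∩ Ioo 0 τ with hS
  have hSS : ∫ x in {y | s < k y}, g x ∂μ = ∫ x in S, g x := by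
    rw [hμ, Measure.restrict_restrict₀ hset]
  rw [hSS]
  rcases S.eq_empty_or_nonempty with he | hne
  · simp [he]
  have hbdd : BddBelow S := ⟨0, fun y hy => hy.2.1.le⟩
  obtain ⟨y₀, hy₀⟩ := hne
  have hc₀ : 0 ≤ sInf S := le_csInf ⟨y₀, hy₀⟩ fun y hy => hy.2.1.le
  have hcτ : sInf S < τ := (csInf_le hbdd hy₀).trans_lt hy₀.2.2
  -- By monotonicity of `k`, `S` is an end interval up to one point, so its integral is a tail.
  have hsub₁ : Ioo (sInf S) τ ⊆ S := by
    intro y hy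
    obtain ⟨z, hz, hzy⟩ := exists_lt_of_csInf_lt ⟨y₀, hy₀⟩ hy.1
    have hyI : y ∈ Ioo 0 τ := ⟨hc₀.trans_lt hy.1, hy.2⟩
    exact ⟨lt_of_lt_of_le hz.1 (hk hz.2 hyI hzy.le), hyI⟩
  have hsub₂ : S ⊆ Ico (sInf S) τ := fun y hy => ⟨csInf_le hbdd hy, hy.2.2⟩
  have hae : S =ᵐ[volume] Ioo (sInf S) τ :=
    (hsub₂.eventuallyLE.trans Ioo_ae_eq_Ico.symm.le).antisymm hsub₁.eventuallyLE
  rw [setIntegral_congr_set hae]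
  exact htail _ ⟨hc₀, hcτ⟩

/-! ### Convergence of the Mittag-Leffler series -/

/-- Keep only `x > R` in Euler's integral and bound `x ^ (s - 1)` below by `R ^ (s - 1)`. -/
theorem Real.rpow_mul_exp_neg_le_Gamma {R s : ℝ} (hR : 0 ≤ R) (hs : 1 ≤ s) :
    R ^ (s - 1) * Real.exp (-R) ≤ Real.Gamma s := by
  have hs₀ : 0 < s := by linarith
  have hint := Real.GammaIntegral_convergent hs₀
  rw [Real.Gamma_eq_integral hs₀, mul_comm, ← integral_exp_neg_Ioi R, ← integral_mul_const]
  have hsub : Ioi R ⊆ Ioi 0 := Ioi_subset_Ioi hR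
  refine (setIntegral_mono_on ?_ (hint.mono_set hsub) measurableSet_Ioi fun x hx => ?_).trans
    (setIntegral_mono_set hint ?_ hsub.eventuallyLE)
  · exact (integrableOn_exp_neg_Ioi R).mul_const _
  · have : R ≤ x := (mem_Ioi.1 hx).le
    gcongr
  · filter_upwards [ae_restrict_mem measurableSet_Ioi] with x hx
    have : (0 : ℝ) < x := hx
    simp only [Pi.zero_apply]
    positivity

theorem summable_mittagLeffler {α : ℝ} (hα : 0 < α) (z : ℝ) :
    Summable fun n : ℕ => z ^ n / Real.Gamma (n * α + 1) := by
  -- With `R ^ α = A`, `Γ(nα + 1) ≥ A ^ n * exp (-R)`; this `A` makes the ratio `|z| / A` at most `1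
  -- / 2`.
  set A : ℝ := 2 * |z| + 1
  have hA : 0 < A := by positivity
  set R : ℝ := A ^ α⁻¹
  have hR : 0 < R := by positivity
  have hRA : R ^ α = A := by
    rw [← Real.rpow_mul hA.le, inv_mul_cancel₀ hα.ne', Real.rpow_one]
  refine Summable.of_norm_bounded
    ((summable_geometric_of_lt_one (r := 1 / 2) (by norm_num) (by norm_num)).mul_left
      (Real.exp R)) fun n => ?_
  have hG := Real.rpow_mul_exp_neg_le_Gamma hR.le
    (show (1 : ℝ) ≤ n * α + 1 by have : 0 ≤ n * α := by positivity
                                 linarith)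
  rw [add_sub_cancel_right, mul_comm (n : ℝ) α, Real.rpow_mul hR.le, hRA, Real.rpow_natCast] at hG
  have hpos : 0 < A ^ n * Real.exp (-R) := by positivity
  rw [norm_div, norm_pow, Real.norm_eq_abs, mul_comm (n : ℝ) α,
    Real.norm_of_nonneg (hpos.le.trans hG)]
  calc |z| ^ n / Real.Gamma (α * n + 1) ≤ |z| ^ n / (A ^ n * Real.exp (-R)) := by gcongr
    _ = Real.exp R * (|z| / A) ^ n := by
      rw [Real.exp_neg, div_pow]; field_simp
    _ ≤ Real.exp R * (1 / 2) ^ n := by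
      refine mul_le_mul_of_nonneg_left (pow_le_pow_left₀ (by positivity) ?_ n) (by positivity)
      rw [div_le_div_iff₀ hA two_pos]
      simp only [A]
      linarith

theorem mittagLeffler_zero (α : ℝ) : mittagLeffler α 0 = 1 := by
  rw [mittagLeffler, tsum_eq_single 0 fun n hn => by simp [hn]]
  simp

/-! ### Termwise fractional integration -/

/-- Euler's Beta integral on `[0, t]`. -/
theorem integral_rpow_mul_sub_rpow {p q t : ℝ} (hp : 0 < p) (hq : 0 < q) (ht : 0 < t) :
    ∫ x in Ioo 0 t, x ^ (p - 1) * (t - x) ^ (q - 1) =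
      t ^ (p + q - 1) * (Real.Gamma p * Real.Gamma q / Real.Gamma (p + q)) := by
  have h := Complex.betaIntegral_scaled p q ht
  rw [Complex.betaIntegral_eq_Gamma_mul_div _ _ (by simpa) (by simpa)] at h
  rw [← integral_Ioc_eq_integral_Ioo, ← intervalIntegral.integral_of_le ht.le]
  apply Complex.ofReal_injective
  rw [← intervalIntegral.integral_ofReal]
  convert h using 1
  · refine intervalIntegral.integral_congr fun x hx => ?_
    rw [uIcc_of_le ht.le] at hx
    simp only [Complex.ofReal_mul]
    rw [Complex.ofReal_cpow hx.1, Complex.ofReal_cpow (sub_nonneg.2 hx.2)]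
    push_cast
    rfl
  · push_cast [Complex.ofReal_cpow ht.le, ← Complex.Gamma_ofReal]
    rfl

theorem integrableOn_rpow_mul_sub_rpow {p q t : ℝ} (hp : 0 < p) (hq : 0 < q) (ht : 0 < t) :
    IntegrableOn (fun x => x ^ (p - 1) * (t - x) ^ (q - 1)) (Ioo 0 t) := by
  -- A nonintegrable function has integral `0` by convention, so a nonzero value suffices.
  refine .of_integral_ne_zero ?_
  rw [integral_rpow_mul_sub_rpow hp hq ht]
  have := Real.Gamma_pos_of_pos hp
  have := Real.Gamma_pos_of_pos hq
  have := Real.Gamma_pos_of_pos (add_pos hp hq)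
  positivity

/-- The derivative of `t ↦ E_α(-l t^α)`, as a series. -/
noncomputable def mittagLefflerDeriv (α l s : ℝ) : ℝ :=
  ∑' n : ℕ, (-l) ^ (n + 1) / Real.Gamma ((n + 1) * α) * s ^ ((n + 1) * α - 1)

/-- Termwise integration of `mittagLefflerDeriv` against the kernel `(t - s)^(q - 1)`. -/
theorem integral_mittagLefflerDeriv_mul {α l q t : ℝ} (hα : 0 < α) (hq : 0 < q) (ht : 0 < t)
    (hsum : Summable fun n : ℕ =>
      |l| ^ (n + 1) * t ^ ((n + 1) * α + q - 1) / Real.Gamma ((n + 1) * α + q)) :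
    IntegrableOn (fun s => (t - s) ^ (q - 1) * mittagLefflerDeriv α l s) (Ioo 0 t) ∧
    ∫ s in Ioo 0 t, (t - s) ^ (q - 1) * mittagLefflerDeriv α l s =
      Real.Gamma q * ∑' n : ℕ,
        (-l) ^ (n + 1) * t ^ ((n + 1) * α + q - 1) / Real.Gamma ((n + 1) * α + q) := by
  let F : ℕ → ℝ → ℝ := fun n s =>
    (-l) ^ (n + 1) / Real.Gamma ((n + 1) * α) * (s ^ ((n + 1) * α - 1) * (t - s) ^ (q - 1))
  have hp : ∀ n : ℕ, 0 < ((n : ℝ) + 1) * α := fun n => by positivity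
  have hF : ∀ n, IntegrableOn (F n) (Ioo 0 t) := fun n =>
    (integrableOn_rpow_mul_sub_rpow (hp n) hq ht).const_mul _
  have hnorm : ∀ n, ∫ s in Ioo 0 t, ‖F n s‖ = Real.Gamma q *
      (|l| ^ (n + 1) * t ^ ((n + 1) * α + q - 1) / Real.Gamma ((n + 1) * α + q)) := by
    intro n
    have hG := Real.Gamma_pos_of_pos (hp n)
    have : ∀ s ∈ Ioo 0 t, ‖F n s‖ = |l| ^ (n + 1) / Real.Gamma ((n + 1) * α) *
        (s ^ ((n + 1) * α - 1) * (t - s) ^ (q - 1)) := by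
      intro s hs
      have h₁ : 0 < s := hs.1
      have h₂ : 0 < t - s := sub_pos.2 hs.2
      simp only [F]
      rw [norm_mul, norm_div, norm_pow, norm_neg, Real.norm_eq_abs, Real.norm_of_nonneg hG.le,
        Real.norm_of_nonneg (by positivity)]
    rw [setIntegral_congr_fun measurableSet_Ioo this, integral_const_mul,
      integral_rpow_mul_sub_rpow (hp n) hq ht]
    field_simp
  have hval : ∀ n, ∫ s in Ioo 0 t, F n s = Real.Gamma q *
      ((-l) ^ (n + 1) * t ^ ((n + 1) * α + q - 1) / Real.Gamma ((n + 1) * α + q)) := by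
    intro n
    have hG := Real.Gamma_pos_of_pos (hp n)
    simp only [F]
    rw [integral_const_mul, integral_rpow_mul_sub_rpow (hp n) hq ht]
    field_simp
  have hS : Summable fun n => ∫ s in Ioo 0 t, ‖F n s‖ := by
    simp_rw [hnorm]
    exact hsum.mul_left _
  have hprod : (fun s => (t - s) ^ (q - 1) * mittagLefflerDeriv α l s) =
      fun s => ∑' n, F n s := by
    ext s
    rw [mittagLefflerDeriv, ← tsum_mul_left]
    refine tsum_congr fun n => ?_
    simp only [F]
    ring
  rw [hprod]
  refine ⟨integrable_tsum_of_summable_integral_norm hF hS, ?_⟩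
  rw [← integral_tsum_of_summable_integral_norm hF hS, ← tsum_mul_left]
  exact tsum_congr hval

theorem integral_mittagLefflerDeriv {α l t : ℝ} (hα : 0 < α) (ht : 0 < t) :
    IntegrableOn (mittagLefflerDeriv α l) (Ioo 0 t) ∧
    ∫ s in Ioo 0 t, mittagLefflerDeriv α l s = mittagLeffler α (-l * t ^ α) - 1 := by
  have key : ∀ (z : ℝ) (n : ℕ), z ^ (n + 1) * t ^ (((n : ℝ) + 1) * α + 1 - 1) /
      Real.Gamma ((n + 1) * α + 1) =
      (z * t ^ α) ^ (n + 1) / Real.Gamma ((n + 1 : ℕ) * α + 1) := by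
    intro z n
    rw [mul_pow, ← Real.rpow_natCast (t ^ α), ← Real.rpow_mul ht.le, add_sub_cancel_right]
    push_cast
    rw [mul_comm α]
  have h := integral_mittagLefflerDeriv_mul (l := l) hα one_pos ht (by
    simp_rw [key]
    exact (summable_nat_add_iff 1).2 (summable_mittagLeffler hα (|l| * t ^ α)))
  simp only [sub_self, Real.rpow_zero, one_mul, Real.Gamma_one, key] at h
  refine ⟨h.1, h.2.trans ?_⟩
  rw [mittagLeffler, (summable_mittagLeffler hα _).tsum_eq_zero_add]
  simp

/-- The Caputo equation, up to the factor `Γ(1 - α)`: for `q = 1 - α`, `(n + 1)α + q = nα + 1` and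
the series returns to `E_α`. -/
theorem integral_sub_rpow_mul_mittagLefflerDeriv {α l t : ℝ} (hα : 0 < α) (hα₁ : α < 1)
    (ht : 0 < t) :
    IntegrableOn (fun s => (t - s) ^ (-α) * mittagLefflerDeriv α l s) (Ioo 0 t) ∧
    ∫ s in Ioo 0 t, (t - s) ^ (-α) * mittagLefflerDeriv α l s =
      -(l * Real.Gamma (1 - α)) * mittagLeffler α (-l * t ^ α) := by
  have key : ∀ (z : ℝ) (n : ℕ), z ^ (n + 1) * t ^ (((n : ℝ) + 1) * α + (1 - α) - 1) /
      Real.Gamma ((n + 1) * α + (1 - α)) =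
      z * ((z * t ^ α) ^ n / Real.Gamma (n * α + 1)) := by
    intro z n
    rw [mul_pow, ← Real.rpow_natCast (t ^ α), ← Real.rpow_mul ht.le,
      show ((n : ℝ) + 1) * α + (1 - α) = n * α + 1 by ring, add_sub_cancel_right, mul_comm α]
    ring
  have h := integral_mittagLefflerDeriv_mul (l := l) hα (sub_pos.2 hα₁) ht (by
    simp_rw [key]
    exact (summable_mittagLeffler hα (|l| * t ^ α)).mul_left _)
  simp only [key, show 1 - α - 1 = -α by ring] at h
  refine ⟨h.1, h.2.trans ?_⟩
  rw [tsum_mul_left, mittagLeffler]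
  ring

/-! ### Sign and monotonicity of `E_α` on the negative axis -/

/-- At a minimum point `t` over `[0, 1]` of the difference of the functions
`t ↦ E_α(-l₁ t^α)` and `t ↦ E_α(-l₂ t^α)`, the Caputo derivative of the difference is
nonpositive. -/
theorem exists_min_mittagLeffler_sub {α : ℝ} (hα : 0 < α) (hα₁ : α < 1) (l₁ l₂ : ℝ) :
    ∃ t ∈ Icc (0 : ℝ) 1,
      mittagLeffler α (-l₁ * t ^ α) - mittagLeffler α (-l₂ * t ^ α) ≤
        min 0 (mittagLeffler α (-l₁) - mittagLeffler α (-l₂)) ∧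
      (0 < t → l₂ * mittagLeffler α (-l₂ * t ^ α) ≤ l₁ * mittagLeffler α (-l₁ * t ^ α)) := by
  set y : ℝ → ℝ := fun t => mittagLeffler α (-l₁ * t ^ α) - mittagLeffler α (-l₂ * t ^ α) with hy
  set h : ℝ → ℝ := fun s => mittagLefflerDeriv α l₁ s - mittagLefflerDeriv α l₂ s with hh
  have hy₀ : y 0 = 0 := by simp [hy, Real.zero_rpow hα.ne']
  have hint : ∀ t, 0 < t → IntegrableOn h (Ioo 0 t) := fun t ht =>
    (integral_mittagLefflerDeriv hα ht).1.sub (integral_mittagLefflerDeriv hα ht).1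
  have hprim : ∀ t, 0 ≤ t → y t = ∫ s in (0 : ℝ)..t, h s := by
    intro t ht
    rcases ht.eq_or_lt with rfl | ht
    · simp [hy₀]
    · obtain ⟨i₁, e₁⟩ := integral_mittagLefflerDeriv (l := l₁) hα ht
      obtain ⟨i₂, e₂⟩ := integral_mittagLefflerDeriv (l := l₂) hα ht
      rw [intervalIntegral.integral_of_le ht.le, integral_Ioc_eq_integral_Ioo, hh,
        integral_sub i₁ i₂, e₁, e₂]
      simp [hy]
  have hii : ∀ t, 0 < t → IntervalIntegrable h volume 0 t := fun t ht => by
    rw [intervalIntegrable_iff_integrableOn_Ioo_of_le ht.le]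
    exact hint t ht
  have hcont : ContinuousOn y (Icc 0 1) := by
    have := intervalIntegral.continuousOn_primitive_interval' (hii 1 one_pos) left_mem_uIcc
    rw [uIcc_of_le zero_le_one] at this
    exact this.congr fun t ht => hprim t ht.1
  obtain ⟨t, ht, hmin⟩ := isCompact_Icc.exists_isMinOn (nonempty_Icc.2 zero_le_one) hcont
  have hmin' : ∀ c ∈ Icc (0 : ℝ) 1, y t ≤ y c := fun c hc => hmin hc
  refine ⟨t, ht, le_min ?_ ?_, fun ht₀ => ?_⟩
  · exact (hmin' 0 (by simp)).trans_eq hy₀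
  · simpa [hy] using hmin' 1 (by simp)
  obtain ⟨i₁, e₁⟩ := integral_sub_rpow_mul_mittagLefflerDeriv (l := l₁) hα hα₁ ht₀
  obtain ⟨i₂, e₂⟩ := integral_sub_rpow_mul_mittagLefflerDeriv (l := l₂) hα hα₁ ht₀
  have hfun : (fun s => (t - s) ^ (-α) * -h s) = fun s =>
      (t - s) ^ (-α) * mittagLefflerDeriv α l₂ s - (t - s) ^ (-α) * mittagLefflerDeriv α l₁ s := by
    ext s
    simp only [hh]
    ring
  have key : 0 ≤ ∫ s in Ioo 0 t, (t - s) ^ (-α) * -h s := by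
    refine integral_mul_nonneg_of_monotoneOn (fun s hs => ?_) (fun a ha b hb hab => ?_)
      (hint t ht₀).neg ?_ fun c hc => ?_
    · exact Real.rpow_nonneg (sub_nonneg.2 hs.2.le) _
    · exact Real.rpow_le_rpow_of_nonpos (sub_pos.2 hb.2) (by linarith) (by linarith)
    · rw [hfun]
      exact i₂.sub i₁
    -- The tail of `-h` over `(c, t)` is `y c - y t`, nonnegative by minimality.
    · rw [integral_neg, ← integral_Ioc_eq_integral_Ioo, ← intervalIntegral.integral_of_le hc.2.le]
      have hadd := intervalIntegral.integral_interval_sub_left (hii t ht₀)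
        (show IntervalIntegrable h volume 0 c from
          (hii t ht₀).mono_set (by
            rw [uIcc_of_le hc.1, uIcc_of_le ht.1]
            exact Icc_subset_Icc_right hc.2.le))
      rw [← hprim t ht.1, ← hprim c hc.1] at hadd
      have := hmin' c ⟨hc.1, hc.2.le.trans ht.2⟩
      linarith
  rw [hfun, integral_sub i₂ i₁, e₁, e₂] at key
  have hG : 0 < Real.Gamma (1 - α) := Real.Gamma_pos_of_pos (by linarith)
  refine le_of_mul_le_mul_left ?_ hG
  linarith

theorem mittagLeffler_nonneg_of_nonpos {α : ℝ} (hα : 0 < α) (hα₁ : α < 1) {z : ℝ} (hz : z ≤ 0) :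
    0 ≤ mittagLeffler α z := by
  rcases hz.eq_or_lt with rfl | hz
  · simp [mittagLeffler_zero]
  -- Comparison with `u_0 = 1`: at the minimum `0 ≤ -z * u(t)`, so `0 ≤ u(t) ≤ u(1) = E_α(z)`.
  obtain ⟨t, ht, hmin, hd⟩ := exists_min_mittagLeffler_sub hα hα₁ (-z) 0
  simp only [neg_neg, neg_zero, zero_mul, mittagLeffler_zero] at hmin hd
  have h₁ := hmin.trans (min_le_right _ _)
  rcases ht.1.eq_or_lt with h | h
  · simp only [← h, Real.zero_rpow hα.ne', mul_zero, mittagLeffler_zero] at h₁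
    linarith
  · have := nonneg_of_mul_nonneg_right (hd h) (neg_pos.2 hz)
    linarith

/-- For `l₁ = -b ≤ l₂ = -a`, the minimum gives `l₂ u₂ ≤ l₁ u₁ ≤ l₂ u₁`, the last step by `u₁ ≥ 0`.
So the minimum of `u₁ - u₂` is nonnegative. -/
theorem mittagLeffler_monotoneOn_Iic {α : ℝ} (hα : 0 < α) (hα₁ : α < 1) :
    MonotoneOn (mittagLeffler α) (Iic 0) := by
  intro a ha b hb hab
  rcases (mem_Iic.1 ha).eq_or_lt with rfl | ha
  · rw [le_antisymm hb hab]
  obtain ⟨t, ht, hmin, hd⟩ := exists_min_mittagLeffler_sub hα hα₁ (-b) (-a)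
  simp only [neg_neg] at hmin hd
  have h₁ := hmin.trans (min_le_right _ _)
  rcases ht.1.eq_or_lt with h | h
  · simp only [← h, Real.zero_rpow hα.ne', mul_zero, sub_self] at h₁
    linarith
  · have hu := mittagLeffler_nonneg_of_nonpos hα hα₁
      (mul_nonpos_of_nonpos_of_nonneg hb (Real.rpow_nonneg ht.1 α))
    have h₂ := mul_nonneg (sub_nonneg.2 hab) hu
    have h₃ : 0 ≤ -a * (mittagLeffler α (b * t ^ α) - mittagLeffler α (a * t ^ α)) := by
      linarith [hd h]
    have := nonneg_of_mul_nonneg_right h₃ (neg_pos.2 ha)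
    linarith

/-! ### The ABC kernel and the comparison principle -/

theorem mittagLeffler_kernel_nonneg {α l τ : ℝ} (hα : 0 < α) (hα₁ : α < 1) (hl : 0 ≤ l)
    {σ : ℝ} (hσ : σ ≤ τ) : 0 ≤ mittagLeffler α (-l * (τ - σ) ^ α) :=
  mittagLeffler_nonneg_of_nonpos hα hα₁ <|
    mul_nonpos_of_nonpos_of_nonneg (neg_nonpos.2 hl) (Real.rpow_nonneg (sub_nonneg.2 hσ) α)

theorem mittagLeffler_kernel_monotoneOn {α l τ : ℝ} (hα : 0 < α) (hα₁ : α < 1) (hl : 0 ≤ l) :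
    MonotoneOn (fun σ => mittagLeffler α (-l * (τ - σ) ^ α)) (Iic τ) := by
  have hneg : ∀ σ ∈ Iic τ, -l * (τ - σ) ^ α ∈ Iic 0 := fun σ hσ =>
    mul_nonpos_of_nonpos_of_nonneg (neg_nonpos.2 hl) (Real.rpow_nonneg (sub_nonneg.2 hσ) α)
  intro a ha b hb hab
  refine mittagLeffler_monotoneOn_Iic hα hα₁ (hneg a ha) (hneg b hb) ?_
  exact mul_le_mul_of_nonpos_left
    (Real.rpow_le_rpow (sub_nonneg.2 hb) (by linarith) hα.le) (neg_nonpos.2 hl)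

theorem integrableOn_mittagLeffler_kernel_mul {α l τ : ℝ} (hα : 0 < α) (hα₁ : α < 1)
    (hl : 0 ≤ l) {g : ℝ → ℝ} (hg : IntegrableOn g (Ioo 0 τ)) :
    IntegrableOn (fun σ => mittagLeffler α (-l * (τ - σ) ^ α) * g σ) (Ioo 0 τ) := by
  have hmono := mittagLeffler_kernel_monotoneOn (τ := τ) hα hα₁ hl
  have hm : AEStronglyMeasurable (fun σ => mittagLeffler α (-l * (τ - σ) ^ α))
      (volume.restrict (Ioo 0 τ)) :=
    (aemeasurable_restrict_of_monotoneOn measurableSet_Ioo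
      (hmono.mono fun x hx => hx.2.le)).aestronglyMeasurable
  -- The bound `1` is `E_α(0)`, the kernel at `σ = τ`.
  refine Integrable.bdd_mul hg hm (c := 1) ?_
  filter_upwards [ae_restrict_mem measurableSet_Ioo] with σ hσ
  rw [Real.norm_of_nonneg (mittagLeffler_kernel_nonneg hα hα₁ hl hσ.2.le)]
  have := hmono (mem_Iic.2 hσ.2.le) (mem_Iic.2 le_rfl) hσ.2.le
  simpa [Real.zero_rpow hα.ne', mittagLeffler_zero] using this

/-- If `v - w` attains its maximum over `[0, τ]` at `τ`, then the ABC derivative of `v` at `τ` is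
at least that of `w`. -/
theorem abcDeriv_le_abcDeriv_of_isMaxOn {B : ℝ → ℝ} {α τ : ℝ} (hB : 0 ≤ B α) (hα : 0 < α)
    (hα₁ : α < 1) (hτ : 0 ≤ τ) {v w : ℝ → ℝ}
    (hv : DifferentiableOn ℝ v (Icc 0 τ)) (hw : DifferentiableOn ℝ w (Icc 0 τ))
    (hv' : IntegrableOn (deriv v) (Icc 0 τ)) (hw' : IntegrableOn (deriv w) (Icc 0 τ))
    (hmax : IsMaxOn (fun x => v x - w x) (Icc 0 τ) τ) :
    abcDeriv B α w τ ≤ abcDeriv B α v τ := by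
  have hl : 0 ≤ α / (1 - α) := div_nonneg hα.le (by linarith)
  have hvI := hv'.mono_set Ioo_subset_Icc_self
  have hwI := hw'.mono_set Ioo_subset_Icc_self
  unfold abcDeriv
  refine mul_le_mul_of_nonneg_left ?_ (div_nonneg hB (by linarith))
  rw [intervalIntegral.integral_of_le hτ, intervalIntegral.integral_of_le hτ,
    integral_Ioc_eq_integral_Ioo, integral_Ioc_eq_integral_Ioo, ← sub_nonneg,
    ← integral_sub (integrableOn_mittagLeffler_kernel_mul hα hα₁ hl hvI)
      (integrableOn_mittagLeffler_kernel_mul hα hα₁ hl hwI)]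
  simp_rw [← mul_sub]
  refine integral_mul_nonneg_of_monotoneOn
    (fun σ hσ => mittagLeffler_kernel_nonneg hα hα₁ hl hσ.2.le)
    ((mittagLeffler_kernel_monotoneOn hα hα₁ hl).mono fun x hx => hx.2.le) (hvI.sub hwI)
    (integrableOn_mittagLeffler_kernel_mul hα hα₁ hl (hvI.sub hwI)) fun c hc => ?_
  have hsub : Icc c τ ⊆ Icc 0 τ := Icc_subset_Icc_left hc.1
  have hftc : ∫ x in c..τ, (deriv v x - deriv w x) = (v τ - w τ) - (v c - w c) := by
    refine intervalIntegral.integral_eq_sub_of_hasDerivAt_of_le (f := fun x => v x - w x) hc.2.le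
      ((hv.continuousOn.sub hw.continuousOn).mono hsub) (fun x hx => ?_) ?_
    · have hx' : Icc 0 τ ∈ nhds x := Icc_mem_nhds (hc.1.trans_lt hx.1) hx.2
      exact (hv.differentiableAt hx').hasDerivAt.sub (hw.differentiableAt hx').hasDerivAt
    · rw [intervalIntegrable_iff_integrableOn_Icc_of_le hc.2.le]
      exact (hv'.sub hw').mono_set hsub
  rw [← integral_Ioc_eq_integral_Ioo, ← intervalIntegral.integral_of_le hc.2.le, hftc]
  exact sub_nonneg.2 (hmax ⟨hc.1, hc.2.le⟩)

theorem mainTheorem2 (B : ℝ → ℝ) (hB : IsNormalizationFunction B)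
    (α : ℝ) (hα₀ : 0 < α) (hα₁ : α < 1) (T : ℝ) (hT : 0 < T)
    (f : ℝ → ℝ → ℝ) (hf : ContinuousOn (Function.uncurry f) (Icc 0 T ×ˢ univ))
    (v w : ℝ → ℝ)
    (hv : DifferentiableOn ℝ v (Icc 0 T)) (hw : DifferentiableOn ℝ w (Icc 0 T))
    (hv' : IntegrableOn (deriv v) (Icc 0 T)) (hw' : IntegrableOn (deriv w) (Icc 0 T))
    (hDv : ContinuousOn (abcDeriv B α v) (Icc 0 T))
    (hDw : ContinuousOn (abcDeriv B α w) (Icc 0 T))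
    (hle : ∀ τ ∈ Icc 0 T, abcDeriv B α v τ ≤ f τ (v τ))
    (hge : ∀ τ ∈ Icc 0 T, f τ (w τ) ≤ abcDeriv B α w τ)
    (hstrict : (∀ τ ∈ Icc 0 T, abcDeriv B α v τ < f τ (v τ)) ∨
      (∀ τ ∈ Icc 0 T, f τ (w τ) < abcDeriv B α w τ))
    (h₀ : v 0 < w 0) :
    ∀ τ ∈ Icc 0 T, v τ < w τ := by
  by_contra! hcon
  obtain ⟨s, hs, hws⟩ := hcon
  have hcont : ContinuousOn (fun x => v x - w x) (Icc 0 T) := hv.continuousOn.sub hw.continuousOn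
  set S : Set ℝ := Icc 0 T ∩ (fun x => v x - w x) ⁻¹' Ici 0 with hS
  have hSc : IsCompact S :=
    isCompact_Icc.of_isClosed_subset (hcont.preimage_isClosed_of_isClosed isClosed_Icc isClosed_Ici)
      inter_subset_left
  -- `τ` is the first time at which `w ≤ v`.
  obtain ⟨τ, hτS, hτmin⟩ := hSc.exists_isLeast ⟨s, hs, sub_nonneg.2 hws⟩
  have hτ : τ ∈ Icc 0 T := hτS.1
  have hneg : ∀ x ∈ Ico 0 τ, v x - w x < 0 := by
    intro x hx
    by_contra! hx'
    exact (hτmin ⟨⟨hx.1, hx.2.le.trans hτ.2⟩, hx'⟩).not_gt hx.2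
  have hsub : Icc 0 τ ⊆ Icc 0 T := Icc_subset_Icc_right hτ.2
  have hzero : v τ - w τ = 0 := by
    obtain ⟨x, hx, hx₀⟩ := intermediate_value_Icc hτ.1 (hcont.mono hsub)
      (show (0 : ℝ) ∈ Icc (v 0 - w 0) (v τ - w τ) from ⟨by linarith, hτS.2⟩)
    rcases hx.2.eq_or_lt with rfl | hlt
    · exact hx₀
    · exact absurd hx₀ (hneg x ⟨hx.1, hlt⟩).ne
  have hmax : IsMaxOn (fun x => v x - w x) (Icc 0 τ) τ := by
    intro x hx
    change v x - w x ≤ v τ - w τ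
    rcases hx.2.eq_or_lt with rfl | hlt
    · exact le_rfl
    · exact (hneg x ⟨hx.1, hlt⟩).le.trans hzero.ge
  have key := abcDeriv_le_abcDeriv_of_isMaxOn (hB.1 α ⟨hα₀.le, hα₁.le⟩).le hα₀ hα₁ hτ.1
    (hv.mono hsub) (hw.mono hsub) (hv'.mono_set hsub) (hw'.mono_set hsub) hmax
  have heq : f τ (v τ) = f τ (w τ) := by rw [sub_eq_zero.1 hzero]
  have h₁ := hle τ hτ
  have h₂ := hge τ hτ
  rcases hstrict with h | h
  · have := h τ hτ
    linarith
  · have := h τ hτ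
    linarith
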